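/- Let $p$ be a prime and let $G$ be a $p$-adic Lie group, that is, a group which is a finite-dimensional analytic manifold over $\mathbb{Q}_p$ with analytic multiplication and inversion; no linearity, $\sigma$-compactness or second countability is assumed. Call a topological group nearly simple if every closed subnormal subgroup of it is open or discrete. Then there are $n\in\mathbb{N}_0$ and a series $$G=G_0\rhd G_1\rhd\cdots\rhd G_n=\{1\}$$ of closed subgroups $G_j$ of $G$, where each $G_j$ is normal in $G_{j-1}$ (but not necessarily in $G$), such that the topological group $G_{j-1}/G_j$ (with the quotient topology) is nearly simple for every $j\in\{1,\ldots,n\}$. -/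

import Mathlib

open scoped Manifold ContDiff

/-- A topological group is *nearly simple* if each of its closed subnormal subgroups is open in the
group or discrete (in the subspace topology). -/
def NearlySimple (G : Type*) [Group G] [TopologicalSpace G] : Prop :=
  ∀ S : Subgroup G, S.IsSubnormal → IsClosed (S : Set G) →
    IsOpen (S : Set G) ∨ DiscreteTopology S

/-- `IsNearlySimpleSection A B`: `B` is a normal subgroup of `A`, and the quotient group `A / B`,
with the quotient topology of the subspace topology on `A`, is nearly simple. -/
def IsNearlySimpleSection {G : Type*} [Group G] [TopologicalSpace G] (A B : Subgroup G) : Prop :=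
  B ≤ A ∧ ∃ _ : (B.subgroupOf A).Normal, NearlySimple (A ⧸ B.subgroupOf A)

open Topology

/-! A non-nearly-simple quotient A/B has a closed subnormal S strictly between in size: S is not
open in A, nor B in S. Refinement must stop if closed subgroups carry a bounded monotone size that
drops on passing to a closed non-open subgroup (`IsSubgroupDimension`).

The size replaces Lie-theoretic dimension. Near 1 there are coordinates in which the product is the
sum up to a relative error p⁻². Count the vectors mod p that occur as n-th digits of elements of
order at least n (`leadingDigitsDim`). Taking p-th powers shifts digits up one place, so these
finite sets increase with n and stabilise. If H ≤ K realise the same digits, an element of K near 1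
is approximated digit by digit by elements of H, hence lies in the closed group H; so H is open in
K. Only C¹ smoothness at 1 enters. -/

/-- `B` is a closed normal subgroup of the closed subgroup `A`. -/
def IsClosedNormalIn {G : Type*} [Group G] [TopologicalSpace G] (A B : Subgroup G) : Prop :=
  IsClosed (A : Set G) ∧ IsClosed (B : Set G) ∧ B ≤ A ∧ (B.subgroupOf A).Normal

/-- A closed section of a topological group whose quotient is nearly simple. -/
def IsClosedNearlySimpleSection {G : Type*} [Group G] [TopologicalSpace G]
    (A B : Subgroup G) : Prop :=
  IsClosed (A : Set G) ∧ IsClosed (B : Set G) ∧ IsNearlySimpleSection A B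

/-- A dimension function on closed subgroups: it is monotone, and a closed subgroup of full
dimension is open. -/
structure IsSubgroupDimension {G : Type*} [Group G] [TopologicalSpace G]
    (dim : Subgroup G → ℕ) : Prop where
  mono : ∀ {A B : Subgroup G}, IsClosed (A : Set G) → IsClosed (B : Set G) → B ≤ A → dim B ≤ dim A
  isOpen : ∀ {A B : Subgroup G}, IsClosed (A : Set G) → IsClosed (B : Set G) → B ≤ A →
    dim B = dim A → IsOpen (B.subgroupOf A : Set A)

/-! ### Refining closed subnormal series by a dimension function -/

section Topological

variable {G : Type*} [Group G] [TopologicalSpace G] [IsTopologicalGroup G]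

theorem normal_subgroupOf_topologicalClosure {A B : Subgroup G} (hBA : B ≤ A)
    (h : (B.subgroupOf A).Normal) :
    (B.topologicalClosure.subgroupOf A.topologicalClosure).Normal := by
  have hconj : ∀ a ∈ A, ∀ b ∈ B, a * b * a⁻¹ ∈ B := fun a ha b hb =>
    h.conj_mem ⟨b, hBA hb⟩ hb ⟨a, ha⟩
  have h1 : ∀ a ∈ A, ∀ b ∈ closure (B : Set G), a * b * a⁻¹ ∈ closure (B : Set G) := by
    intro a ha b hb
    exact map_mem_closure (f := fun b => a * b * a⁻¹) (by fun_prop) hb (fun b hb => hconj a ha b hb)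
  have h2 : ∀ b ∈ closure (B : Set G), ∀ a ∈ closure (A : Set G),
      a * b * a⁻¹ ∈ closure (B : Set G) := by
    intro b hb a ha
    have := map_mem_closure (f := fun a => a * b * a⁻¹) (t := closure (B : Set G))
      (by fun_prop) ha (fun a ha => h1 a ha b hb)
    rwa [closure_closure] at this
  exact ⟨fun b hb a => h2 b.1 hb a.1 a.2⟩

/-- A closed subnormal subgroup of a closed subgroup is reached by a chain of closed subgroups,
each normal in the preceding one. -/
theorem reflTransGen_isClosedNormalIn {A : Subgroup G} (hA : IsClosed (A : Set G))
    {K : Subgroup A} (hK : K.IsSubnormal) :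
    Relation.ReflTransGen IsClosedNormalIn A (K.map A.subtype).topologicalClosure := by
  induction hK with
  | top =>
    have : ((⊤ : Subgroup A).map A.subtype).topologicalClosure = A := by
      rw [← MonoidHom.range_eq_map, Subgroup.range_subtype]
      exact SetLike.coe_injective hA.closure_eq
    rw [this]
  | step N M hNM _ hN ih =>
    refine ih.tail ⟨Subgroup.isClosed_topologicalClosure _, Subgroup.isClosed_topologicalClosure _,
      Subgroup.topologicalClosure_mono (Subgroup.map_mono hNM),
      normal_subgroupOf_topologicalClosure (Subgroup.map_mono hNM) ⟨?_⟩⟩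
    rintro ⟨_, hn⟩ ⟨n, hnN, rfl⟩ ⟨_, m, hm, rfl⟩
    exact ⟨m * n * m⁻¹, hN.conj_mem ⟨n, hNM hnN⟩ hnN ⟨m, hm⟩, by simp⟩

/-- If the quotient by a closed normal subgroup is not nearly simple, then there is an intermediate
closed subnormal subgroup `S` such that neither `S` is open in `A` nor `B` is open in `S`. -/
theorem exists_intermediate_of_not_nearlySimple {A B : Subgroup G}
    (hA : IsClosed (A : Set G)) (hBA : B ≤ A) (hN : (B.subgroupOf A).Normal)
    (h : ¬ NearlySimple (A ⧸ B.subgroupOf A)) :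
    ∃ S : Subgroup G, IsClosed (S : Set G) ∧ B ≤ S ∧ S ≤ A ∧
      Relation.ReflTransGen IsClosedNormalIn A S ∧
      ¬ IsOpen (S.subgroupOf A : Set A) ∧ ¬ IsOpen (B.subgroupOf S : Set S) := by
  simp only [NearlySimple, not_forall, not_or] at h
  obtain ⟨S, hS, hSc, hSo, hSd⟩ := h
  set π : A →* A ⧸ B.subgroupOf A := QuotientGroup.mk' (B.subgroupOf A) with hπ
  set T : Subgroup A := S.comap π with hT
  have hTc : IsClosed (T : Set A) := hSc.preimage QuotientGroup.continuous_mk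
  have hTG : IsClosed ((T.map A.subtype : Subgroup G) : Set G) := by
    rw [Subgroup.coe_map]
    exact hA.isClosedMap_subtype_val _ hTc
  have hsub : (T.map A.subtype).subgroupOf A = T :=
    Subgroup.comap_map_eq_self_of_injective A.subtype_injective T
  refine ⟨T.map A.subtype, hTG, ?_, Subgroup.map_subtype_le T, ?_, ?_, ?_⟩
  · intro b hb
    refine ⟨⟨b, hBA hb⟩, ?_, rfl⟩
    have : π ⟨b, hBA hb⟩ = 1 := (QuotientGroup.eq_one_iff _).2 hb
    simp [hT, this, one_mem]
  -- Intermediate terms of the subnormal chain need not be closed. Passing to closures repairs this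
  -- and fixes the closed end.
  · have := reflTransGen_isClosedNormalIn hA (hS.comap π)
    rwa [show (T.map A.subtype).topologicalClosure = T.map A.subtype from
      SetLike.coe_injective hTG.closure_eq] at this
  · rw [hsub]
    intro ho
    exact hSo ((QuotientGroup.isQuotientMap_mk (N := B.subgroupOf A)).isOpen_preimage.1 ho)
  · intro ho
    apply hSd
    obtain ⟨O, hO, hOB⟩ := isOpen_induced_iff.1 ho
    -- `O` meets the preimage of `S` exactly in `B`, so the open image of `O` meets `S` only in 1.
    have hone : IsOpen ({1} : Set S) := by
      refine isOpen_induced_iff.2 ⟨π '' (Subtype.val ⁻¹' O),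
        QuotientGroup.isOpenMap_coe _ (hO.preimage continuous_subtype_val), ?_⟩
      ext ⟨s, hs⟩
      simp only [Set.mem_preimage, Set.mem_image, Set.mem_singleton_iff]
      constructor
      · rintro ⟨a, haO, rfl⟩
        have : (⟨a.1, ⟨a, hs, rfl⟩⟩ : (T.map A.subtype : Subgroup G)) ∈ Subtype.val ⁻¹' O := haO
        rw [hOB] at this
        exact Subtype.ext ((QuotientGroup.eq_one_iff _).2 this)
      · intro h1
        refine ⟨1, ?_, ?_⟩
        · have : (1 : (T.map A.subtype : Subgroup G)) ∈ Subtype.val ⁻¹' O := by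
            rw [hOB]; exact one_mem _
          exact this
        · rw [map_one]; exact (congrArg Subtype.val h1).symm
    exact discreteTopology_of_isOpen_singleton_one hone

/-- A dimension function lets every closed normal section be refined into nearly simple sections. -/
theorem IsSubgroupDimension.reflTransGen_nearlySimple {dim : Subgroup G → ℕ}
    (hdim : IsSubgroupDimension dim) {A B : Subgroup G} (h : IsClosedNormalIn A B) :
    Relation.ReflTransGen IsClosedNearlySimpleSection A B := by
  induction hk : dim A - dim B using Nat.strong_induction_on generalizing A B with
  | _ k ih =>
  obtain ⟨hA, hB, hBA, hN⟩ := h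
  by_cases hs : NearlySimple (A ⧸ B.subgroupOf A)
  · exact .single ⟨hA, hB, hBA, hN, hs⟩
  obtain ⟨S, hS, hBS, hSA, hchain, hSo, hBo⟩ :=
    exists_intermediate_of_not_nearlySimple hA hBA hN hs
  have h1 : dim B < dim S :=
    (hdim.mono hS hB hBS).lt_of_ne fun e => hBo (hdim.isOpen hS hB hBS e)
  have h2 : dim S < dim A :=
    (hdim.mono hA hS hSA).lt_of_ne fun e => hSo (hdim.isOpen hA hS hSA e)
  -- `S` is only subnormal in `A`, so each link X/Y of its chain is refined separately. As S ≤ Y ≤ X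
  -- ≤ A, its dimension drop is at most dim A - dim S, which is less than dim A - dim B.
  have key : ∀ T, Relation.ReflTransGen IsClosedNormalIn A T →
      T ≤ A ∧ (S ≤ T → Relation.ReflTransGen IsClosedNearlySimpleSection A T) := by
    intro T hT
    induction hT with
    | refl => exact ⟨le_rfl, fun _ => .refl⟩
    | @tail X Y _ hXY ihX =>
      refine ⟨hXY.2.2.1.trans ihX.1, fun hSY => (ihX.2 (hSY.trans hXY.2.2.1)).trans ?_⟩
      refine ih (dim X - dim Y) ?_ hXY rfl
      have h3 := hdim.mono hA hXY.1 ihX.1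
      have h4 := hdim.mono hXY.2.1 hS hSY
      omega
  refine ((key S hchain).2 le_rfl).trans (ih (dim S - dim B) (by omega) ⟨hS, hB, hBS, ⟨?_⟩⟩ rfl)
  intro b hb s
  exact hN.conj_mem ⟨b.1, hBA hb⟩ hb ⟨s.1, hSA s.2⟩

end Topological

theorem exists_nearlySimple_series_of_reflTransGen {G : Type*} [Group G] [TopologicalSpace G]
    {A B : Subgroup G} (hA : IsClosed (A : Set G))
    (h : Relation.ReflTransGen IsClosedNearlySimpleSection A B) :
    ∃ (n : ℕ) (H : ℕ → Subgroup G), H 0 = A ∧ H n = B ∧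
      (∀ j ≤ n, IsClosed (H j : Set G)) ∧ ∀ j < n, IsNearlySimpleSection (H j) (H (j + 1)) := by
  induction h using Relation.ReflTransGen.head_induction_on with
  | refl => exact ⟨0, fun _ => B, rfl, rfl, fun _ _ => hA, by simp⟩
  | @head X Y hXY _ ih =>
    obtain ⟨n, H, h0, hn, hc, hs⟩ := ih hXY.2.1
    refine ⟨n + 1, fun j => Nat.casesOn j X H, rfl, hn, ?_, ?_⟩
    · rintro (_ | j) hj
      · exact hA
      · exact hc j (by omega)
    · rintro (_ | j) hj
      · simpa [h0] using hXY.2.2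
      · exact hs j (by omega)

/-- Coordinates `φ` with values in `ℚ_[p] ^ ι` on an open subgroup `U`, for which multiplication
is addition up to an error of smaller order. -/
structure IsPadicCoordinate (p : ℕ) [Fact p.Prime] {ι G : Type*} [Fintype ι] [Group G]
    [TopologicalSpace G] (U : Subgroup G) (φ : G → ι → ℚ_[p]) : Prop where
  norm_mul_sub_le : ∀ x ∈ U, ∀ y ∈ U,
    ‖φ (x * y) - φ x - φ y‖ ≤ (p : ℝ)⁻¹ ^ 2 * max ‖φ x‖ ‖φ y‖
  ball_mem_nhds : ∀ n : ℕ, {g | g ∈ U ∧ ‖φ g‖ ≤ (p : ℝ)⁻¹ ^ n} ∈ 𝓝 (1 : G)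
  exists_ball_subset : ∀ s ∈ 𝓝 (1 : G), ∃ n : ℕ, ∀ g ∈ U, ‖φ g‖ ≤ (p : ℝ)⁻¹ ^ n → g ∈ s

/-! ### p-adic digits and ultrametric estimates -/

section Digits

variable {p : ℕ} [Fact p.Prime] {ι : Type*}

theorem Padic.inv_prime_pos : 0 < (p : ℝ)⁻¹ :=
  inv_pos.2 (mod_cast (Fact.out : p.Prime).pos)

theorem Padic.inv_prime_lt_one : (p : ℝ)⁻¹ < 1 :=
  inv_lt_one_of_one_lt₀ (mod_cast (Fact.out : p.Prime).one_lt)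

theorem Padic.norm_prime_pow (n : ℕ) : ‖(p : ℚ_[p]) ^ n‖ = (p : ℝ)⁻¹ ^ n := by
  rw [norm_pow, Padic.norm_p]

/-- The vector of `p`-adic numbers with the given digits. -/
noncomputable def digitVector (a : ι → Fin p) : ι → ℚ_[p] := fun i => ((a i : ℕ) : ℚ_[p])

variable [Fintype ι]

theorem norm_digitVector_le (a : ι → Fin p) : ‖digitVector a‖ ≤ 1 :=
  (pi_norm_le_iff_of_nonneg zero_le_one).2 fun i => 
    IsUltrametricDist.norm_natCast_le_one ℚ_[p] (a i : ℕ)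

theorem exists_norm_sub_smul_digitVector_le {x : ι → ℚ_[p]} {n : ℕ}
    (hx : ‖x‖ ≤ (p : ℝ)⁻¹ ^ n) :
    ∃ a : ι → Fin p, ‖x - (p : ℚ_[p]) ^ n • digitVector a‖ ≤ (p : ℝ)⁻¹ ^ (n + 1) := by
  have hp0 : (p : ℚ_[p]) ≠ 0 := mod_cast (Fact.out : p.Prime).ne_zero
  have hq : 0 < (p : ℝ)⁻¹ ^ n := pow_pos Padic.inv_prime_pos n
  have key : ∀ i, ∃ k : Fin p,
      ‖x i - (p : ℚ_[p]) ^ n * ((k : ℕ) : ℚ_[p])‖ ≤ (p : ℝ)⁻¹ ^ (n + 1) := by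
    intro i
    have hu : ‖x i / (p : ℚ_[p]) ^ n‖ ≤ 1 := by
      rw [norm_div, Padic.norm_prime_pow, div_le_one hq]
      exact (norm_le_pi_norm x i).trans hx
    set u : ℤ_[p] := ⟨x i / (p : ℚ_[p]) ^ n, hu⟩ with hudef
    refine ⟨⟨u.zmodRepr, u.zmodRepr_lt_p⟩, ?_⟩
    have h1 : ‖u - u.zmodRepr‖ ≤ (p : ℝ) ^ (-1 : ℤ) := by
      rw [PadicInt.norm_le_pow_iff_norm_lt_pow_add_one]
      simpa using u.norm_sub_zmodRepr_lt_one
    have h2 : x i - (p : ℚ_[p]) ^ n * (u.zmodRepr : ℚ_[p]) =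
        (p : ℚ_[p]) ^ n * ((u - u.zmodRepr : ℤ_[p]) : ℚ_[p]) := by
      push_cast
      rw [mul_sub, hudef, mul_div_cancel₀ _ (pow_ne_zero n hp0)]
    rw [h2, norm_mul, Padic.norm_prime_pow, pow_succ, ← PadicInt.norm_def]
    exact mul_le_mul_of_nonneg_left (by simpa using h1) hq.le
  choose k hk using key
  exact ⟨k, (pi_norm_le_iff_of_nonneg (pow_pos Padic.inv_prime_pos _).le).2 hk⟩

end Digits

theorem IsUltrametricDist.norm_sub_le_max {E : Type*} [SeminormedAddCommGroup E]
    [IsUltrametricDist E] (x y : E) : ‖x - y‖ ≤ max ‖x‖ ‖y‖ := by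
  simpa [sub_eq_add_neg] using IsUltrametricDist.norm_add_le_max x (-y)

theorem IsUltrametricDist.norm_le_of_norm_sub_le {E : Type*} [SeminormedAddCommGroup E]
    [IsUltrametricDist E] {x y : E} {r : ℝ} (h : ‖x - y‖ ≤ r) (hy : ‖y‖ ≤ r) : ‖x‖ ≤ r := by
  simpa using (IsUltrametricDist.norm_add_le_max (x - y) y).trans (max_le h hy)

/-- The leading digits of those elements of a subgroup with coordinates of order `n`. -/
def leadingDigits {p : ℕ} [Fact p.Prime] {ι G : Type*} [Fintype ι] [Group G]
    (U : Subgroup G) (φ : G → ι → ℚ_[p]) (H : Subgroup G) (n : ℕ) : Set (ι → Fin p) :=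
  {a | ∃ h ∈ H, h ∈ U ∧ ‖φ h - (p : ℚ_[p]) ^ n • digitVector a‖ ≤ (p : ℝ)⁻¹ ^ (n + 1)}

/-- The number of leading digits occurring in a subgroup. -/
noncomputable def leadingDigitsDim {p : ℕ} [Fact p.Prime] {ι G : Type*} [Fintype ι] [Group G]
    (U : Subgroup G) (φ : G → ι → ℚ_[p]) (H : Subgroup G) : ℕ :=
  (⋃ n, leadingDigits U φ H n).ncard

theorem leadingDigits_subset {p : ℕ} [Fact p.Prime] {ι G : Type*} [Fintype ι] [Group G]
    {U : Subgroup G} {φ : G → ι → ℚ_[p]} {H K : Subgroup G} (hHK : H ≤ K) (n : ℕ) :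
    leadingDigits U φ H n ⊆ leadingDigits U φ K n := by
  rintro a ⟨h, hH, hU, ha⟩
  exact ⟨h, hHK hH, hU, ha⟩

/-! ### Leading digits detect open subgroups -/

namespace IsPadicCoordinate

variable {p : ℕ} [Fact p.Prime] {ι G : Type*} [Fintype ι] [Group G] [TopologicalSpace G]
  {U : Subgroup G} {φ : G → ι → ℚ_[p]}

theorem inv_sq_mul_le {r : ℝ} (hr : 0 ≤ r) : (p : ℝ)⁻¹ ^ 2 * r ≤ r :=
  mul_le_of_le_one_left hr (pow_le_one₀ Padic.inv_prime_pos.le Padic.inv_prime_lt_one.le)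

theorem norm_eq_zero_of_le {r : ℝ} (hr : 0 ≤ r) (h : r ≤ (p : ℝ)⁻¹ ^ 2 * r) : r = 0 := by
  by_contra hne
  have : (p : ℝ)⁻¹ ^ 2 < 1 :=
    pow_lt_one₀ Padic.inv_prime_pos.le Padic.inv_prime_lt_one two_ne_zero
  have hpos : 0 < r := lt_of_le_of_ne hr (Ne.symm hne)
  nlinarith

theorem map_one (hφ : IsPadicCoordinate p U φ) : φ 1 = 0 := by
  have h := hφ.norm_mul_sub_le 1 U.one_mem 1 U.one_mem
  rw [mul_one, sub_self, zero_sub, norm_neg, max_self] at h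
  exact norm_eq_zero.1 (norm_eq_zero_of_le (norm_nonneg _) h)

/-- Approximate cancellation: were ‖φ z‖ > r, the ultrametric inequality would make the
multiplication error at least ‖φ z‖, against the factor p⁻². -/
theorem norm_right_le (hφ : IsPadicCoordinate p U φ) {x z : G} (hx : x ∈ U) (hz : z ∈ U) {r : ℝ}
    (h1 : ‖φ (x * z) - φ x‖ ≤ r) (h2 : (p : ℝ)⁻¹ ^ 2 * ‖φ x‖ ≤ r) : ‖φ z‖ ≤ r := by
  have h := hφ.norm_mul_sub_le x hx z hz
  by_contra! hlt
  have hmax : ‖φ z‖ ≤ max ‖φ (x * z) - φ x‖ ‖φ (x * z) - φ x - φ z‖ := by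
    simpa using IsUltrametricDist.norm_sub_le_max (φ (x * z) - φ x) (φ (x * z) - φ x - φ z)
  have h3 : ‖φ z‖ ≤ ‖φ (x * z) - φ x - φ z‖ := by
    rcases le_max_iff.1 hmax with h' | h'
    · exact absurd (h'.trans h1) (not_le.2 hlt)
    · exact h'
  rcases le_total ‖φ x‖ ‖φ z‖ with hxz | hxz
  · rw [max_eq_right hxz] at h
    have h0 := norm_eq_zero_of_le (norm_nonneg _) (h3.trans h)
    have : 0 ≤ (p : ℝ)⁻¹ ^ 2 * ‖φ x‖ := by positivity
    linarith
  · rw [max_eq_left hxz] at h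
    linarith

theorem norm_inv_le (hφ : IsPadicCoordinate p U φ) {x : G} (hx : x ∈ U) : ‖φ x⁻¹‖ ≤ ‖φ x‖ :=
  hφ.norm_right_le hx (U.inv_mem hx) (by simp [hφ.map_one]) (inv_sq_mul_le (norm_nonneg _))

theorem norm_pow_sub_le (hφ : IsPadicCoordinate p U φ) {x : G} (hx : x ∈ U) (k : ℕ) :
    ‖φ (x ^ k) - (k : ℚ_[p]) • φ x‖ ≤ (p : ℝ)⁻¹ ^ 2 * ‖φ x‖ := by
  induction k with
  | zero => simp only [pow_zero, hφ.map_one, Nat.cast_zero, zero_smul, sub_self, norm_zero]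
            positivity
  | succ k ih =>
    have hk : ‖φ (x ^ k)‖ ≤ ‖φ x‖ := by
      refine IsUltrametricDist.norm_le_of_norm_sub_le
        (ih.trans (inv_sq_mul_le (norm_nonneg _))) ?_
      rw [norm_smul]
      exact mul_le_of_le_one_left (norm_nonneg _) (IsUltrametricDist.norm_natCast_le_one _ _)
    have h := hφ.norm_mul_sub_le (x ^ k) (U.pow_mem hx k) x hx
    rw [max_eq_right hk, ← pow_succ] at h
    have e : φ (x ^ (k + 1)) - ((k + 1 : ℕ) : ℚ_[p]) • φ x =
        (φ (x ^ (k + 1)) - φ (x ^ k) - φ x) + (φ (x ^ k) - (k : ℚ_[p]) • φ x) := by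
      push_cast
      rw [add_smul, one_smul]
      abel
    rw [e]
    exact (IsUltrametricDist.norm_add_le_max _ _).trans (max_le h ih)

theorem norm_le_of_norm_sub_digitVector_le {x : ι → ℚ_[p]} {a : ι → Fin p} {n : ℕ}
    (h : ‖x - (p : ℚ_[p]) ^ n • digitVector a‖ ≤ (p : ℝ)⁻¹ ^ (n + 1)) :
    ‖x‖ ≤ (p : ℝ)⁻¹ ^ n := by
  refine IsUltrametricDist.norm_le_of_norm_sub_le (h.trans
    (pow_le_pow_of_le_one Padic.inv_prime_pos.le Padic.inv_prime_lt_one.le n.le_succ)) ?_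
  rw [norm_smul, Padic.norm_prime_pow]
  exact mul_le_of_le_one_right (pow_pos Padic.inv_prime_pos n).le (norm_digitVector_le a)

/-- φ(h^p) is p φ(h) up to p⁻²‖φ h‖ ≤ p^(-(n+2)), so the digits reappear one place higher. An error
factor of p⁻¹ would not suffice. -/
theorem leadingDigits_mono (hφ : IsPadicCoordinate p U φ) (H : Subgroup G) :
    Monotone (leadingDigits U φ H) := by
  refine monotone_nat_of_le_succ fun n a => ?_
  rintro ⟨h, hH, hU, ha⟩
  refine ⟨h ^ p, H.pow_mem hH p, U.pow_mem hU p, ?_⟩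
  have e : φ (h ^ p) - (p : ℚ_[p]) ^ (n + 1) • digitVector a =
      (φ (h ^ p) - (p : ℚ_[p]) • φ h) +
        (p : ℚ_[p]) • (φ h - (p : ℚ_[p]) ^ n • digitVector a) := by
    rw [smul_sub, smul_smul, ← pow_succ']
    abel
  rw [e]
  refine (IsUltrametricDist.norm_add_le_max _ _).trans (max_le ?_ ?_)
  · refine (hφ.norm_pow_sub_le hU p).trans ?_
    rw [show n + 1 + 1 = 2 + n by ring, pow_add]
    exact mul_le_mul_of_nonneg_left (norm_le_of_norm_sub_digitVector_le ha) (by positivity)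
  · rw [norm_smul, Padic.norm_p, pow_succ' _ (n + 1)]
    exact mul_le_mul_of_nonneg_left ha (by positivity)

/-- A closed subgroup having all leading digits of a larger group contains a neighbourhood of `1`
in that group. -/
theorem mem_of_leadingDigits_subset [IsTopologicalGroup G] (hφ : IsPadicCoordinate p U φ)
    {H K : Subgroup G} (hH : IsClosed (H : Set G)) (hHK : H ≤ K) {N : ℕ}
    (hN : ∀ n ≥ N, leadingDigits U φ K n ⊆ leadingDigits U φ H n) {k : G} (hk : k ∈ K)
    (hkU : k ∈ U) (hkN : ‖φ k‖ ≤ (p : ℝ)⁻¹ ^ N) : k ∈ H := by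
  -- Each step multiplies `h` by an element of `H` that cancels the next digit of `h⁻¹ * k`.
  have approx : ∀ m : ℕ, ∃ h ∈ H, h⁻¹ * k ∈ U ∧ ‖φ (h⁻¹ * k)‖ ≤ (p : ℝ)⁻¹ ^ (N + m) := by
    intro m
    induction m with
    | zero => exact ⟨1, H.one_mem, by simpa using hkU, by simpa using hkN⟩
    | succ m ih =>
      obtain ⟨h, hhH, hhU, hh⟩ := ih
      obtain ⟨a, ha⟩ := exists_norm_sub_smul_digitVector_le hh
      obtain ⟨g, hgH, hgU, hg⟩ := hN (N + m) (by omega)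
        ⟨h⁻¹ * k, K.mul_mem (K.inv_mem (hHK hhH)) hk, hhU, ha⟩
      have hz : g⁻¹ * (h⁻¹ * k) ∈ U := U.mul_mem (U.inv_mem hgU) hhU
      refine ⟨h * g, H.mul_mem hhH hgH, ?_, ?_⟩
      · rwa [mul_inv_rev, mul_assoc]
      · rw [mul_inv_rev, mul_assoc]
        refine hφ.norm_right_le hgU hz ?_ ?_
        · rw [mul_inv_cancel_left, ← sub_sub_sub_cancel_right _ _
            ((p : ℚ_[p]) ^ (N + m) • digitVector a)]
          exact (IsUltrametricDist.norm_sub_le_max _ _).trans (max_le ha hg)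
        · calc (p : ℝ)⁻¹ ^ 2 * ‖φ g‖ ≤ (p : ℝ)⁻¹ ^ 2 * (p : ℝ)⁻¹ ^ (N + m) :=
                mul_le_mul_of_nonneg_left (norm_le_of_norm_sub_digitVector_le hg) (by positivity)
            _ ≤ (p : ℝ)⁻¹ ^ (N + (m + 1)) := by
                rw [← pow_add]
                exact pow_le_pow_of_le_one Padic.inv_prime_pos.le Padic.inv_prime_lt_one.le
                  (by omega)
  rw [← SetLike.mem_coe, ← hH.closure_eq, mem_closure_iff_nhds]
  intro t ht
  have ht' : (fun z => k * z) ⁻¹' t ∈ 𝓝 (1 : G) :=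
    (continuous_const_mul k).continuousAt.preimage_mem_nhds (by simpa using ht)
  obtain ⟨n, hn⟩ := hφ.exists_ball_subset _ ht'
  obtain ⟨h, hhH, hhU, hh⟩ := approx n
  refine ⟨h, ?_, hhH⟩
  have := hn (h⁻¹ * k)⁻¹ (U.inv_mem hhU) ((hφ.norm_inv_le hhU).trans (hh.trans
    (pow_le_pow_of_le_one Padic.inv_prime_pos.le Padic.inv_prime_lt_one.le (by omega))))
  simpa using this

theorem isOpen_of_leadingDigitsDim_eq [IsTopologicalGroup G] (hφ : IsPadicCoordinate p U φ)
    {H K : Subgroup G} (hH : IsClosed (H : Set G)) (hHK : H ≤ K)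
    (h : leadingDigitsDim U φ H = leadingDigitsDim U φ K) :
    IsOpen (H.subgroupOf K : Set K) := by
  have heq : (⋃ n, leadingDigits U φ H n) = ⋃ n, leadingDigits U φ K n :=
    Set.eq_of_subset_of_ncard_le (Set.iUnion_mono (leadingDigits_subset hHK)) h.ge (Set.toFinite _)
  -- An increasing union that is finite is attained at some level.
  obtain ⟨N, hN⟩ : ∃ N, (⋃ n, leadingDigits U φ H n) ⊆ leadingDigits U φ H N := by
    have := (hφ.leadingDigits_mono H).directed_le.exists_mem_subset_of_finset_subset_biUnion
      (s := (Set.toFinite (⋃ n, leadingDigits U φ H n)).toFinset) (by simp)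
    simpa only [Set.Finite.coe_toFinset] using this
  have hsub : ∀ n ≥ N, leadingDigits U φ K n ⊆ leadingDigits U φ H n := fun n hn =>
    (Set.subset_iUnion _ n).trans (heq.symm.subset.trans (hN.trans (hφ.leadingDigits_mono H hn)))
  refine Subgroup.isOpen_of_mem_nhds _ (g := 1) ?_
  rw [nhds_subtype_eq_comap]
  refine Filter.mem_comap.2 ⟨_, hφ.ball_mem_nhds N, ?_⟩
  rintro ⟨k, hk⟩ ⟨hkU, hkN⟩
  exact hφ.mem_of_leadingDigits_subset hH hHK hsub hk hkU hkN

end IsPadicCoordinate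

/-! ### Coordinates from a chart at the identity -/

section Chart

variable {p : ℕ} [Fact p.Prime] {ι G : Type*} [Fintype ι] [Group G] [TopologicalSpace G]
  [ChartedSpace (ι → ℚ_[p]) G]

/-- The preferred chart at `1`, translated so that `1` has coordinate `0`. -/
noncomputable def coordinateAtOne (g : G) : ι → ℚ_[p] :=
  extChartAt 𝓘(ℚ_[p], ι → ℚ_[p]) (1 : G) g - extChartAt 𝓘(ℚ_[p], ι → ℚ_[p]) (1 : G) 1

theorem eventually_norm_coordinateAtOne_le (n : ℕ) :
    ∀ᶠ g in 𝓝 (1 : G), ‖coordinateAtOne (p := p) (ι := ι) g‖ ≤ (p : ℝ)⁻¹ ^ n := by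
  have hc : ContinuousAt (coordinateAtOne (p := p) (ι := ι)) (1 : G) :=
    (continuousAt_extChartAt (1 : G)).sub continuousAt_const
  have h0 : coordinateAtOne (p := p) (ι := ι) (1 : G) = 0 := sub_self _
  have := hc.norm
  rw [ContinuousAt, h0, norm_zero] at this
  exact (this.eventually_lt_const (pow_pos Padic.inv_prime_pos n)).mono fun _ h => h.le

/-- Off the chart source the coordinate is a junk value that may be small, hence the restriction. -/
theorem exists_coordinateAtOne_ball_subset {s : Set G} (hs : s ∈ 𝓝 (1 : G)) :
    ∃ n : ℕ, ∀ g ∈ (chartAt (ι → ℚ_[p]) (1 : G)).source,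
      ‖coordinateAtOne (p := p) (ι := ι) g‖ ≤ (p : ℝ)⁻¹ ^ n → g ∈ s := by
  set e := extChartAt 𝓘(ℚ_[p], ι → ℚ_[p]) (1 : G) with he
  have hc : ContinuousAt e.symm (e 1) := continuousAt_extChartAt_symm (1 : G)
  have h1 : e.symm (e 1) = 1 := extChartAt_to_inv (1 : G)
  obtain ⟨r, hr, hrs⟩ := Metric.mem_nhds_iff.1 (hc.preimage_mem_nhds (by rwa [h1]))
  obtain ⟨n, hn⟩ := exists_pow_lt_of_lt_one hr (Padic.inv_prime_lt_one (p := p))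
  refine ⟨n, fun g hg hgn => ?_⟩
  have hmem : e g ∈ Metric.ball (e 1) r := by
    rw [mem_ball_iff_norm]
    exact hgn.trans_lt hn
  have := hrs hmem
  rwa [Set.mem_preimage, e.left_inv (by rwa [he, extChartAt_source])] at this

/-- In the chart at `1`, multiplication has derivative `(x, y) ↦ x + y`. -/
theorem hasFDerivAt_mul_chart [LieGroup 𝓘(ℚ_[p], ι → ℚ_[p]) 1 G] :
    HasFDerivAt (fun w : (ι → ℚ_[p]) × (ι → ℚ_[p]) =>
      extChartAt 𝓘(ℚ_[p], ι → ℚ_[p]) (1 : G)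
        ((extChartAt 𝓘(ℚ_[p], ι → ℚ_[p]) (1 : G)).symm w.1 *
          (extChartAt 𝓘(ℚ_[p], ι → ℚ_[p]) (1 : G)).symm w.2))
      (ContinuousLinearMap.fst ℚ_[p] _ _ + ContinuousLinearMap.snd ℚ_[p] _ _)
      (extChartAt 𝓘(ℚ_[p], ι → ℚ_[p]) (1 : G) 1, extChartAt 𝓘(ℚ_[p], ι → ℚ_[p]) (1 : G) 1) := by
  set e := extChartAt 𝓘(ℚ_[p], ι → ℚ_[p]) (1 : G) with he
  have h1 : e.symm (e 1) = 1 := extChartAt_to_inv (1 : G)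
  set F : (ι → ℚ_[p]) × (ι → ℚ_[p]) → ι → ℚ_[p] := fun w => e (e.symm w.1 * e.symm w.2) with hF
  have hsymm : ContMDiffAt 𝓘(ℚ_[p], ι → ℚ_[p]) 𝓘(ℚ_[p], ι → ℚ_[p]) 1 e.symm (e 1) :=
    (contMDiffOn_extChartAt_symm (1 : G)).contMDiffAt (extChartAt_target_mem_nhds (1 : G))
  have hmul : ContMDiffAt 𝓘(ℚ_[p], (ι → ℚ_[p]) × (ι → ℚ_[p])) 𝓘(ℚ_[p], ι → ℚ_[p]) 1
      (fun w : (ι → ℚ_[p]) × (ι → ℚ_[p]) => e.symm w.1 * e.symm w.2) (e 1, e 1) :=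
    (ContMDiffAt.comp (e 1, e 1) hsymm contDiffAt_fst.contMDiffAt).mul
      (ContMDiffAt.comp (e 1, e 1) hsymm contDiffAt_snd.contMDiffAt)
  have hchart : ContMDiffAt 𝓘(ℚ_[p], ι → ℚ_[p]) 𝓘(ℚ_[p], ι → ℚ_[p]) 1 e
      (e.symm (e 1) * e.symm (e 1)) := by
    rw [h1, mul_one]
    exact contMDiffAt_extChartAt
  have hFd : DifferentiableAt ℚ_[p] F (e 1, e 1) :=
    (ContMDiffAt.comp (e 1, e 1) hchart hmul).contDiffAt.differentiableAt one_ne_zero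
  have hinv : ∀ᶠ u in 𝓝 (e 1), e (e.symm u) = u :=
    Filter.mem_of_superset (extChartAt_target_mem_nhds (I := 𝓘(ℚ_[p], ι → ℚ_[p])) (1 : G))
      fun u hu => e.right_inv hu
  have hid : ∀ {f : (ι → ℚ_[p]) → ι → ℚ_[p]}, (∀ u, e (e.symm u) = u → f u = u) →
      HasFDerivAt f (ContinuousLinearMap.id ℚ_[p] (ι → ℚ_[p])) (e 1) := fun hf =>
    (hasFDerivAt_id (e 1)).congr_of_eventuallyEq (hinv.mono hf)
  -- Since 1 · u = u = u · 1, both partial maps are the identity near `e 1`; uniqueness of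
  -- derivatives gives both components.
  have hleft := (HasFDerivAt.comp (f := fun u => (u, e 1)) (e 1) hFd.hasFDerivAt
    (hasFDerivAt_prodMk_left (e 1) (e 1))).unique
    (hid fun u hu => by simp [hF, h1, hu])
  have hright := (HasFDerivAt.comp (f := fun u => (e 1, u)) (e 1) hFd.hasFDerivAt
    (hasFDerivAt_prodMk_right (e 1) (e 1))).unique
    (hid fun u hu => by simp [hF, h1, hu])
  convert hFd.hasFDerivAt using 1
  ext1
  · simpa using hleft.symm
  · simpa using hright.symm

/-- This is Fréchet differentiability at (1, 1) with ε = p⁻²; the sup norm on the product gives the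
maximum. -/
theorem eventually_norm_coordinateAtOne_mul_sub_le [LieGroup 𝓘(ℚ_[p], ι → ℚ_[p]) 1 G] :
    ∀ᶠ z in 𝓝 ((1, 1) : G × G),
      ‖coordinateAtOne (p := p) (ι := ι) (z.1 * z.2) - coordinateAtOne z.1 - coordinateAtOne z.2‖ ≤
        (p : ℝ)⁻¹ ^ 2 * max ‖coordinateAtOne (p := p) (ι := ι) z.1‖
          ‖coordinateAtOne (p := p) (ι := ι) z.2‖ := by
  have hD := (hasFDerivAt_mul_chart (p := p) (ι := ι) (G := G)).isLittleO.def
    (pow_pos (Padic.inv_prime_pos (p := p)) 2)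
  set e := extChartAt 𝓘(ℚ_[p], ι → ℚ_[p]) (1 : G) with he
  have h1 : e.symm (e 1) = 1 := extChartAt_to_inv (1 : G)
  have hc : ContinuousAt (fun z : G × G => (e z.1, e z.2)) (1, 1) :=
    (ContinuousAt.comp (x := ((1, 1) : G × G)) (continuousAt_extChartAt (1 : G))
      continuousAt_fst).prodMk
      (ContinuousAt.comp (x := ((1, 1) : G × G)) (continuousAt_extChartAt (1 : G))
        continuousAt_snd)
  have hsrc : ∀ᶠ g in 𝓝 (1 : G), e.symm (e g) = g :=
    Filter.mem_of_superset (extChartAt_source_mem_nhds (I := 𝓘(ℚ_[p], ι → ℚ_[p])) (1 : G))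
      fun g hg => e.left_inv hg
  filter_upwards [hc.eventually hD, hsrc.prodMk_nhds hsrc] with z hz hzs
  simp only [hzs.1, hzs.2, h1, mul_one] at hz
  refine le_trans (le_of_eq ?_) hz
  congr 1
  simp only [coordinateAtOne, ← he, add_apply, ContinuousLinearMap.coe_fst',
    ContinuousLinearMap.coe_snd', Prod.mk_sub_mk]
  abel

variable (p ι G) in
/-- Every `p`-adic Lie group has an open subgroup with coordinates in which multiplication is
addition up to an error of smaller order. -/
theorem exists_isPadicCoordinate [IsTopologicalGroup G] [LieGroup 𝓘(ℚ_[p], ι → ℚ_[p]) 1 G] :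
    ∃ (U : Subgroup G) (φ : G → ι → ℚ_[p]), IsPadicCoordinate p U φ := by
  set S := (chartAt (ι → ℚ_[p]) (1 : G)).source with hS
  have hSn : S ∈ 𝓝 (1 : G) := chart_source_mem_nhds _ _
  have hprod : ∀ᶠ z in 𝓝 ((1, 1) : G × G), z.1 * z.2 ∈ S :=
    continuous_mul.continuousAt.preimage_mem_nhds (by simpa using hSn)
  have hboth := hprod.and (eventually_norm_coordinateAtOne_mul_sub_le (p := p) (ι := ι) (G := G))
  rw [nhds_prod_eq, Filter.eventually_prod_self_iff'] at hboth
  obtain ⟨t, ht, hts⟩ := hboth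
  obtain ⟨n, hn⟩ := exists_coordinateAtOne_ball_subset (p := p) (ι := ι) ht
  set V : Set G := {g | g ∈ S ∧ ‖coordinateAtOne (p := p) (ι := ι) g‖ ≤ (p : ℝ)⁻¹ ^ n} with hV
  have hVt : ∀ g ∈ V, g ∈ t := fun g hg => hn g hg.1 hg.2
  have hVn : V ∈ 𝓝 (1 : G) := Filter.inter_mem hSn (eventually_norm_coordinateAtOne_le n)
  have hVmul : ∀ x ∈ V, ∀ y ∈ V, x * y ∈ V := by
    intro x hx y hy
    obtain ⟨h1, h2⟩ := hts x (hVt x hx) y (hVt y hy)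
    refine ⟨h1, ?_⟩
    have hmax := max_le hx.2 hy.2
    refine IsUltrametricDist.norm_le_of_norm_sub_le (y := coordinateAtOne x + coordinateAtOne y)
      ?_ ((IsUltrametricDist.norm_add_le_max _ _).trans hmax)
    rw [← sub_sub]
    exact h2.trans ((IsPadicCoordinate.inv_sq_mul_le (le_max_of_le_left (norm_nonneg _))).trans
      hmax)
  have h1V : (1 : G) ∈ V := mem_of_mem_nhds hVn
  -- `V` is closed under products, but perhaps not under inverses.
  let U : Subgroup G :=
    { carrier := {g | g ∈ V ∧ g⁻¹ ∈ V}
      one_mem' := ⟨h1V, by simpa using h1V⟩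
      mul_mem' := fun {x y} hx hy =>
        ⟨hVmul x hx.1 y hy.1, by rw [mul_inv_rev]; exact hVmul _ hy.2 _ hx.2⟩
      inv_mem' := fun {x} hx => ⟨hx.2, by simpa using hx.1⟩ }
  have hUn : {g | g ∈ U} ∈ 𝓝 (1 : G) :=
    Filter.inter_mem hVn (inv_mem_nhds_one G hVn)
  refine ⟨U, coordinateAtOne, fun x hx y hy => (hts x (hVt x hx.1) y (hVt y hy.1)).2,
    fun m => Filter.inter_mem hUn (eventually_norm_coordinateAtOne_le m), fun s hs => ?_⟩
  obtain ⟨m, hm⟩ := exists_coordinateAtOne_ball_subset (p := p) (ι := ι) hs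
  exact ⟨m, fun g hg => hm g hg.1.1⟩

end Chart

theorem IsPadicCoordinate.isSubgroupDimension {p : ℕ} [Fact p.Prime] {ι G : Type*} [Fintype ι]
    [Group G] [TopologicalSpace G] [IsTopologicalGroup G] {U : Subgroup G} {φ : G → ι → ℚ_[p]}
    (hφ : IsPadicCoordinate p U φ) : IsSubgroupDimension (leadingDigitsDim U φ) where
  mono _ _ hBA :=
    Set.ncard_le_ncard (Set.iUnion_mono (leadingDigits_subset hBA)) (Set.toFinite _)
  isOpen _ hB hBA h := hφ.isOpen_of_leadingDigitsDim_eq hB hBA h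

/-- `G` is a `p`-adic Lie group: an analytic manifold over `ℚ_[p]` modelled on `ℚ_[p] ^ d`, with
analytic multiplication and inversion (`ω` is the analytic order of smoothness). It has a finite
series of closed subgroups from `G` down to `1` with nearly simple successive quotients. -/
theorem proposition1 (p : ℕ) [Fact p.Prime] (d : ℕ)
    (G : Type*) [Group G] [TopologicalSpace G] [ChartedSpace (Fin d → ℚ_[p]) G]
    [LieGroup 𝓘(ℚ_[p], Fin d → ℚ_[p]) ω G] :
    ∃ (n : ℕ) (H : ℕ → Subgroup G),
      H 0 = ⊤ ∧ H n = ⊥ ∧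
      (∀ j ≤ n, IsClosed (H j : Set G)) ∧
      ∀ j < n, IsNearlySimpleSection (H j) (H (j + 1)) := by
  have : IsTopologicalGroup G := topologicalGroup_of_lieGroup 𝓘(ℚ_[p], Fin d → ℚ_[p]) ω
  have : T1Space G := ChartedSpace.t1Space (Fin d → ℚ_[p]) G
  obtain ⟨U, φ, hφ⟩ := exists_isPadicCoordinate p (Fin d) G
  refine exists_nearlySimple_series_of_reflTransGen (by simp)
    (hφ.isSubgroupDimension.reflTransGen_nearlySimple ⟨by simp, by simp, bot_le, ?_⟩)
  exact Subgroup.normal_subgroupOf
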